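/- For an integer $n\ge 1$ and integers $a_1,\dots,a_n$ put $$M_n(a_1,\dots,a_n)=\begin{pmatrix}a_n&-1\\1&0\end{pmatrix}\begin{pmatrix}a_{n-1}&-1\\1&0\end{pmatrix}\cdots\begin{pmatrix}a_1&-1\\1&0\end{pmatrix},\qquad S=\begin{pmatrix}0&-1\\1&0\end{pmatrix}.$$ Let $n\ge 5$ and let $P$ be a convex polygon with $n+1$ vertices. A *notched $3d$-dissection* ("$3d$-dissection échancrée") of $P$ is a decomposition of $P$ into sub-polygons by diagonals of $P$ that meet only at vertices of $P$, such that - exactly one of the sub-polygons is a quadrilateral; - every other sub-polygon has a number of vertices that is a multiple of $3$; - exactly two sides of the quadrilateral are sides of $P$, and these two sides have a vertex in common. Number this common vertex $0$ and the other vertices of $P$ counterclockwise $1,\dots,n$. For $1\le i\le n$ let $a_i$ be the number of sub-polygons that have vertex $i$ among their vertices and whose number of vertices is a multiple of $3$. The tuple $(a_1,\dots,a_n)$ is called the *quiddity* of the notched $3d$-dissection. **Theorem.** Let $n\ge 1$ and let $(a_1,\dots,a_n)$ be an $n$-tuple of integers. Then $a_1,\dots,a_n$ are all positive and $M_n(a_1,\dots,a_n)=\pm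 S$ if and only if $n\ge 5$ and $(a_1,\dots,a_n)$ is the quiddity of a notched $3d$-dissection of a convex polygon with $n+1$ vertices. -/

import Mathlib

/-- The product `M_n(a_1, …, a_n) = C(a_n) ⋯ C(a_1)` where `C(x) = (x, -1; 1, 0)`; the tuple is
indexed by `Fin n`, so that `a i` is the entry `a_{i+1}`. -/
def continuantMatrix {n : ℕ} (a : Fin n → ℤ) : Matrix (Fin 2) (Fin 2) ℤ :=
  ((List.ofFn fun i => (!![a i, -1; 1, 0] : Matrix (Fin 2) (Fin 2) ℤ)).reverse).prod

/-- The generator `S` of the modular group. -/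
def matrixS : Matrix (Fin 2) (Fin 2) ℤ := !![0, -1; 1, 0]

/-! The vertices of a convex `N`-gon `P` are numbered `0, …, N - 1` counterclockwise. A segment
joining two distinct vertices is written as the pair `(i, j)` of its end points with `i < j`.
A polygon whose vertices are vertices of `P` is given by its set of vertices (in the same
cyclic order); `P` itself is `Finset.univ`. -/

/-- The segment `e` is a side of the polygon with vertex set `Q`: its end points belong to `Q`
and are consecutive in the cyclic order, that is, no vertex of `Q` lies strictly between them, or
all vertices of `Q` lie between them. -/
def IsPolygonSide {N : ℕ} (Q : Finset (Fin N)) (e : Fin N × Fin N) : Prop :=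
  e.1 ∈ Q ∧ e.2 ∈ Q ∧ e.1 < e.2 ∧
    ((∀ k ∈ Q, k ≤ e.1 ∨ e.2 ≤ k) ∨ (∀ k ∈ Q, e.1 ≤ k ∧ k ≤ e.2))

instance {N : ℕ} (Q : Finset (Fin N)) : DecidablePred (IsPolygonSide Q) := fun e => by
  unfold IsPolygonSide; infer_instance

/-- The segment `e` is a diagonal of the polygon with vertex set `Q`: it joins two
distinct vertices of `Q` and is not a side of it. -/
def IsPolygonDiagonal {N : ℕ} (Q : Finset (Fin N)) (e : Fin N × Fin N) : Prop :=
  e.1 ∈ Q ∧ e.2 ∈ Q ∧ e.1 < e.2 ∧ ¬ IsPolygonSide Q e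

instance {N : ℕ} (Q : Finset (Fin N)) : DecidablePred (IsPolygonDiagonal Q) := fun e => by
  unfold IsPolygonDiagonal; infer_instance

/-- Two segments cross at a point which is not a vertex: their end points
interlace on the boundary of the polygon. -/
def SegmentsCross {N : ℕ} (e f : Fin N × Fin N) : Prop :=
  (e.1 < f.1 ∧ f.1 < e.2 ∧ e.2 < f.2) ∨ (f.1 < e.1 ∧ e.1 < f.2 ∧ f.2 < e.2)

/-- A dissection of a convex `N`-gon: a set of diagonals meeting only at vertices. -/
structure PolygonDissection (N : ℕ) where
  /-- the diagonals that cut the polygon -/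
  cuts : Finset (Fin N × Fin N)
  isDiagonal : ∀ e ∈ cuts, IsPolygonDiagonal Finset.univ e
  noncrossing : ∀ e ∈ cuts, ∀ f ∈ cuts, ¬ SegmentsCross e f

namespace PolygonDissection

variable {N : ℕ} (D : PolygonDissection N)

/-- The polygon with vertex set `Q` is one of the sub-polygons into which `P` is cut: each of its
sides is a side of `P` or a cut, and none of its diagonals is a cut. -/
def IsPiece (Q : Finset (Fin N)) : Prop :=
  3 ≤ Q.card ∧
  (∀ e, IsPolygonSide Q e → IsPolygonSide Finset.univ e ∨ e ∈ D.cuts) ∧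
  (∀ e, IsPolygonDiagonal Q e → e ∉ D.cuts)

instance : DecidablePred D.IsPiece := fun Q => by
  unfold IsPiece; infer_instance

/-- The sub-polygons of the dissection (as vertex sets). -/
def pieces : Finset (Finset (Fin N)) := Finset.univ.filter fun Q => D.IsPiece Q

/-- The number of sub-polygons that use the vertex `v` and whose number of vertices is a
multiple of `3`. -/
def weight (v : Fin N) : ℕ := (D.pieces.filter fun Q => 3 ∣ Q.card ∧ v ∈ Q).card

end PolygonDissection

/-- The sides of the polygon `Q` that are also sides of `P`. -/
def outerSides {N : ℕ} (Q : Finset (Fin N)) : Finset (Fin N × Fin N) :=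
  Finset.univ.filter fun e => IsPolygonSide Q e ∧ IsPolygonSide Finset.univ e

/-- `D` is a notched 3d-dissection (`3d`-dissection échancrée) of a convex `(n+1)`-gon, `n ≥ 5`,
whose vertices are numbered counterclockwise starting from the notch: exactly one sub-polygon is a
quadrilateral, all the others have a number of vertices divisible by `3`, and the
quadrilateral has exactly two sides that are sides of the polygon, with vertex `0` in common. -/
def PolygonDissection.IsNotched {n : ℕ} (D : PolygonDissection (n + 1)) : Prop :=
  5 ≤ n ∧ ∃ q ∈ D.pieces, q.card = 4 ∧
    (∀ Q ∈ D.pieces, Q ≠ q → 3 ∣ Q.card) ∧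
    (outerSides q).card = 2 ∧ (∀ e ∈ outerSides q, e.1 = 0 ∨ e.2 = 0)

/-- The quiddity `(a_1, …, a_n)` of a notched dissection: `a_i` is the number of sub-polygons with a
number of vertices divisible by `3` that use the vertex `i`. The entry of index
`i : Fin n` is `a_{i+1}`, read at the vertex `i + 1`. -/
def PolygonDissection.notchedQuiddity {n : ℕ} (D : PolygonDissection (n + 1)) (i : Fin n) : ℤ :=
  D.weight i.succ

/-! Write `C(x)` for the matrix (x, -1; 1, 0), so that `C(0) = S`, `C(1) ^ 3 = -1` and `C(0) ^ 4 =
1`. An uncut piece therefore has product `±1`, with weight 1 at every vertex if its size is a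
multiple of 3, and weight 0 at every vertex if it is the quadrilateral. Gluing two polygons along a
side adds the weights at the two common vertices, and `contProd_glue` shows that a factor of product
`±1` then disappears up to sign. So the weights of all `n + 1` vertices have product `±1`
(`contProd_subWeight`). Vertex 0 meets only the quadrilateral, contributes `C(0) = S`, and `M_n =
±S` follows. Every other vertex lies on a side of `P` avoiding 0; the piece with this side is not
the quadrilateral, so the weight is positive.

Conversely, let a positive word have product `±S`. If some run of ones of length 1 modulo 3 lies
between two entries at least 2, it is an ear: removing it and lowering both neighbours by 1 keeps
positivity and, by gluing, the product up to sign. Induction dissects the smaller polygon, and the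
ear is glued back (`Realizes.ear`). A word without ears acts monotonically on the cone `1 ≤ x < y`,
apart from its first and last runs of ones; comparison with `±S` leaves only `1^r 2 1^s` with `r`
and `s` equal to 2 modulo 3 (`hasEar_or_eq_of_contProd_eq`). This word is the notched quadrilateral
with one ear on each of its two sides away from the notch. -/

section Polygon

/-! ### Pieces of a polygon and cutting along a diagonal -/

variable {N : ℕ}

open Classical in
/-- The pieces into which `cuts` divides the polygon `Q`. -/
noncomputable def subPieces (cuts : Finset (Fin N × Fin N)) (Q : Finset (Fin N)) :
    Finset (Finset (Fin N)) :=
  Q.powerset.filter fun P => 3 ≤ P.card ∧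
    (∀ e, IsPolygonSide P e → IsPolygonSide Q e ∨ e ∈ cuts) ∧
    (∀ e, IsPolygonDiagonal P e → e ∉ cuts)

/-- The number of pieces of `Q` at the vertex `v` whose number of vertices is a multiple of `3`. -/
noncomputable def subWeight (cuts : Finset (Fin N × Fin N)) (Q : Finset (Fin N)) (v : Fin N) : ℕ :=
  ((subPieces cuts Q).filter fun P => 3 ∣ P.card ∧ v ∈ P).card

theorem mem_subPieces {cuts : Finset (Fin N × Fin N)} {Q P : Finset (Fin N)} :
    P ∈ subPieces cuts Q ↔ P ⊆ Q ∧ 3 ≤ P.card ∧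
      (∀ e, IsPolygonSide P e → IsPolygonSide Q e ∨ e ∈ cuts) ∧
      (∀ e, IsPolygonDiagonal P e → e ∉ cuts) := by
  simp [subPieces]

theorem PolygonDissection.pieces_eq_subPieces (D : PolygonDissection N) :
    D.pieces = subPieces D.cuts Finset.univ := by
  ext P
  simp [PolygonDissection.pieces, PolygonDissection.IsPiece, mem_subPieces]

theorem PolygonDissection.weight_eq_subWeight (D : PolygonDissection N) (v : Fin N) :
    D.weight v = subWeight D.cuts Finset.univ v := by
  rw [PolygonDissection.weight, subWeight, D.pieces_eq_subPieces]

theorem isPolygonDiagonal_iff {Q : Finset (Fin N)} {e : Fin N × Fin N} :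
    IsPolygonDiagonal Q e ↔ e.1 ∈ Q ∧ e.2 ∈ Q ∧ e.1 < e.2 ∧ (∃ k ∈ Q, e.1 < k ∧ k < e.2) ∧
      ∃ l ∈ Q, l < e.1 ∨ e.2 < l := by
  unfold IsPolygonDiagonal IsPolygonSide
  constructor
  · rintro ⟨h1, h2, h3, h4⟩
    refine ⟨h1, h2, h3, ?_, ?_⟩ <;> by_contra! h <;> apply h4 <;> refine ⟨h1, h2, h3, ?_⟩
    · exact Or.inl fun k hk => (le_or_gt k e.1).imp id (h k hk)
    · exact Or.inr h
  · rintro ⟨h1, h2, h3, ⟨k, hk, hk1, hk2⟩, l, hl, hl1⟩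
    refine ⟨h1, h2, h3, ?_⟩
    rintro ⟨-, -, -, h | h⟩
    · grind
    · grind

theorem IsPolygonSide.mono {P Q : Finset (Fin N)} (h : P ⊆ Q) {e : Fin N × Fin N}
    (he : IsPolygonSide Q e) (h1 : e.1 ∈ P) (h2 : e.2 ∈ P) : IsPolygonSide P e :=
  ⟨h1, h2, he.2.2.1, he.2.2.2.imp (fun H k hk => H k (h hk)) (fun H k hk => H k (h hk))⟩

theorem IsPolygonDiagonal.mono {P Q : Finset (Fin N)} (h : P ⊆ Q) {e : Fin N × Fin N}
    (he : IsPolygonDiagonal P e) : IsPolygonDiagonal Q e :=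
  ⟨h he.1, h he.2.1, he.2.2.1, fun H => he.2.2.2 (H.mono h he.1 he.2.1)⟩

theorem exists_side_around {P : Finset (Fin N)} {i p q : Fin N} (hi : i ∉ P) (hp : p ∈ P)
    (hq : q ∈ P) (hpi : p < i) (hiq : i < q) :
    ∃ s t, IsPolygonSide P (s, t) ∧ p ≤ s ∧ s < i ∧ i < t ∧ t ≤ q ∧
      ∀ k ∈ P, k ≤ s ∨ t ≤ k := by
  obtain ⟨s, hs, hs'⟩ := (P.filter (· < i)).exists_max_image id ⟨p, by simp [hp, hpi]⟩
  obtain ⟨t, ht, ht'⟩ := (P.filter (i < ·)).exists_min_image id ⟨q, by simp [hq, hiq]⟩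
  simp only [Finset.mem_filter, id, and_imp] at *
  have key : ∀ k ∈ P, k ≤ s ∨ t ≤ k := fun k hk => by
    rcases lt_trichotomy k i with h | h | h
    · exact Or.inl (hs' k hk h)
    · exact absurd (h ▸ hk) hi
    · exact Or.inr (ht' k hk h)
  exact ⟨s, t, ⟨hs.1, ht.1, hs.2.trans ht.2, Or.inl key⟩, hs' p hp hpi, hs.2, ht.2, ht' q hq hiq,
    key⟩

theorem exists_side_min_max {P : Finset (Fin N)} {p q : Fin N} (hp : p ∈ P) (hq : q ∈ P)
    (hpq : p < q) : ∃ s t, IsPolygonSide P (s, t) ∧ ∀ k ∈ P, s ≤ k ∧ k ≤ t := by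
  obtain ⟨s, hs, hs'⟩ := P.exists_min_image id ⟨p, hp⟩
  obtain ⟨t, ht, ht'⟩ := P.exists_max_image id ⟨p, hp⟩
  have key : ∀ k ∈ P, s ≤ k ∧ k ≤ t := fun k hk => ⟨hs' k hk, ht' k hk⟩
  exact ⟨s, t, ⟨hs, ht, ((hs' p hp).trans_lt hpq).trans_le (ht' q hq), Or.inr key⟩, key⟩

theorem exists_mem_ne_ne {P : Finset (Fin N)} (hP : 3 ≤ P.card) (s t : Fin N) :
    ∃ k ∈ P, k ≠ s ∧ k ≠ t := by
  obtain ⟨k, hk, hk'⟩ := Finset.exists_mem_notMem_of_card_lt_card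
    (s := {s, t}) (t := P) (Finset.card_le_two.trans_lt hP)
  exact ⟨k, hk, by simpa using hk'⟩

/-- A vertex `w` of `Q` missed by `P` lies beyond some side of `P`: either the side joining the
neighbours of `w` in `P`, or the closing side from minimum to maximum. That side separates `w` from
a third vertex of `P`. -/
theorem exists_side_isPolygonDiagonal {P Q : Finset (Fin N)} (h : P ⊆ Q) (hne : P ≠ Q)
    (hP : 3 ≤ P.card) : ∃ e, IsPolygonSide P e ∧ IsPolygonDiagonal Q e := by
  obtain ⟨w, hwQ, hwP⟩ := Finset.exists_of_ssubset (h.ssubset_of_ne hne)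
  obtain ⟨a, ha, b, hb, hab⟩ := Finset.one_lt_card.1 (show 1 < P.card by omega)
  by_cases hb' : (∃ p ∈ P, p < w) ∧ ∃ q ∈ P, w < q
  · obtain ⟨⟨p, hp, hpw⟩, q, hq, hwq⟩ := hb'
    obtain ⟨s, t, hst, -, hs, ht, -, hk⟩ := exists_side_around hwP hp hq hpw hwq
    refine ⟨(s, t), hst, isPolygonDiagonal_iff.2
      ⟨h hst.1, h hst.2.1, hst.2.2.1, ⟨w, hwQ, hs, ht⟩, ?_⟩⟩
    obtain ⟨k, hkP, h1, h2⟩ := exists_mem_ne_ne hP s t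
    refine ⟨k, h hkP, ?_⟩
    rcases hk k hkP with h' | h'
    · exact Or.inl (lt_of_le_of_ne h' h1)
    · exact Or.inr (lt_of_le_of_ne h' (Ne.symm h2))
  · obtain ⟨s, t, hst, hk⟩ : ∃ s t, IsPolygonSide P (s, t) ∧ ∀ k ∈ P, s ≤ k ∧ k ≤ t := by
      rcases lt_or_gt_of_ne hab with h | h
      · exact exists_side_min_max ha hb h
      · exact exists_side_min_max hb ha h
    refine ⟨(s, t), hst, isPolygonDiagonal_iff.2
      ⟨h hst.1, h hst.2.1, hst.2.2.1, ?_, w, hwQ, ?_⟩⟩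
    · obtain ⟨k, hkP, h1, h2⟩ := exists_mem_ne_ne hP s t
      exact ⟨k, h hkP, lt_of_le_of_ne (hk k hkP).1 (Ne.symm h1), lt_of_le_of_ne (hk k hkP).2 h2⟩
    · have hs := hst.1
      have ht := hst.2.1
      by_contra! hc
      apply hb'
      refine ⟨⟨s, hs, lt_of_le_of_ne hc.1 ?_⟩, t, ht, lt_of_le_of_ne hc.2 ?_⟩
      · rintro rfl; exact hwP hs
      · rintro rfl; exact hwP ht

/-- If `P` were strictly smaller, one of its sides would be a diagonal of `R`. It is not a side of
`Q`, since it would then be a side of `R`; so it is a cut, which a diagonal of the piece `R` cannot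
be. -/
theorem subPieces_antichain {cuts : Finset (Fin N × Fin N)} {Q P R : Finset (Fin N)}
    (hP : P ∈ subPieces cuts Q) (hR : R ∈ subPieces cuts Q) (h : P ⊆ R) : P = R := by
  rw [mem_subPieces] at hP hR
  by_contra hne
  obtain ⟨e, he, hd⟩ := exists_side_isPolygonDiagonal h hne hP.2.1
  rcases hP.2.2.1 e he with h' | h'
  · exact hd.2.2.2 (h'.mono hR.1 hd.1 hd.2.1)
  · exact hR.2.2.2 e hd h'

theorem subPieces_eq_singleton {cuts : Finset (Fin N × Fin N)} {Q : Finset (Fin N)}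
    (hQ : 3 ≤ Q.card) (h : ∀ e ∈ cuts, ¬ IsPolygonDiagonal Q e) : subPieces cuts Q = {Q} := by
  have hmem : Q ∈ subPieces cuts Q :=
    mem_subPieces.2 ⟨subset_rfl, hQ, fun e he => Or.inl he, fun e he hc => h e hc he⟩
  ext P
  rw [Finset.mem_singleton]
  exact ⟨fun hP => subPieces_antichain hP hmem (mem_subPieces.1 hP).1, fun hP => hP ▸ hmem⟩

/-- The part of the polygon `Q` between the end points of `e`. -/
def innerPart (Q : Finset (Fin N)) (e : Fin N × Fin N) : Finset (Fin N) :=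
  Q.filter fun k => e.1 ≤ k ∧ k ≤ e.2

/-- The part of the polygon `Q` outside the end points of `e`. -/
def outerPart (Q : Finset (Fin N)) (e : Fin N × Fin N) : Finset (Fin N) :=
  Q.filter fun k => k ≤ e.1 ∨ e.2 ≤ k

theorem mem_innerPart {Q : Finset (Fin N)} {e : Fin N × Fin N} {k : Fin N} :
    k ∈ innerPart Q e ↔ k ∈ Q ∧ e.1 ≤ k ∧ k ≤ e.2 := by simp [innerPart]

theorem mem_outerPart {Q : Finset (Fin N)} {e : Fin N × Fin N} {k : Fin N} :
    k ∈ outerPart Q e ↔ k ∈ Q ∧ (k ≤ e.1 ∨ e.2 ≤ k) := by simp [outerPart]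

theorem innerPart_subset (Q : Finset (Fin N)) (e : Fin N × Fin N) : innerPart Q e ⊆ Q :=
  Finset.filter_subset _ _

theorem outerPart_subset (Q : Finset (Fin N)) (e : Fin N × Fin N) : outerPart Q e ⊆ Q :=
  Finset.filter_subset _ _

theorem side_innerPart {Q : Finset (Fin N)} {e s : Fin N × Fin N} (he : IsPolygonDiagonal Q e)
    (hs : IsPolygonSide (innerPart Q e) s) : IsPolygonSide Q s ∨ s = e := by
  obtain ⟨h1, h2, h3, h4⟩ := hs
  have he1 : e.1 ∈ innerPart Q e := mem_innerPart.2 ⟨he.1, le_rfl, he.2.2.1.le⟩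
  have he2 : e.2 ∈ innerPart Q e := mem_innerPart.2 ⟨he.2.1, he.2.2.1.le, le_rfl⟩
  rcases h4 with h4 | h4
  · left
    rw [mem_innerPart] at h1 h2
    refine ⟨h1.1, h2.1, h3, Or.inl fun k hk => ?_⟩
    by_contra! hc
    have := h4 k (mem_innerPart.2 ⟨hk, by order, by order⟩)
    grind
  · right
    have a1 := h4 _ he1
    have a2 := h4 _ he2
    rw [mem_innerPart] at h1 h2
    exact Prod.ext (by order) (by order)

theorem side_outerPart {Q : Finset (Fin N)} {e s : Fin N × Fin N} (he : IsPolygonDiagonal Q e)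
    (hs : IsPolygonSide (outerPart Q e) s) : IsPolygonSide Q s ∨ s = e := by
  obtain ⟨h1, h2, h3, h4⟩ := hs
  have hlt := he.2.2.1
  have he1 : e.1 ∈ outerPart Q e := mem_outerPart.2 ⟨he.1, Or.inl le_rfl⟩
  have he2 : e.2 ∈ outerPart Q e := mem_outerPart.2 ⟨he.2.1, Or.inr le_rfl⟩
  rw [mem_outerPart] at h1 h2
  rcases h4 with h4 | h4
  · by_cases hse : s.1 = e.1 ∧ s.2 = e.2
    · exact Or.inr (Prod.ext hse.1 hse.2)
    · left
      have a1 := h4 _ he1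
      have a2 := h4 _ he2
      refine ⟨h1.1, h2.1, h3, Or.inl fun k hk => ?_⟩
      by_cases hk' : k ∈ outerPart Q e
      · exact h4 k hk'
      · rw [mem_outerPart] at hk'
        grind
  · left
    have a1 := h4 _ he1
    have a2 := h4 _ he2
    refine ⟨h1.1, h2.1, h3, Or.inr fun k hk => ?_⟩
    by_cases hk' : k ∈ outerPart Q e
    · exact h4 k hk'
    · rw [mem_outerPart] at hk'
      grind

/-- Suppose `P` has vertices strictly on both sides of the cut `e`. If an end point of `e` were
missing from `P`, the side of `P` passing over it would cross `e`; but sides of `P` are sides of `Q`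
or cuts, and neither cross `e`. So both end points belong to `P`, and `e` is a cut that is a
diagonal of `P`. -/
theorem subset_innerPart_or_outerPart {cuts : Finset (Fin N × Fin N)} {Q P : Finset (Fin N)}
    {e : Fin N × Fin N} (he : e ∈ cuts) (hd : IsPolygonDiagonal Q e)
    (hcross : ∀ f ∈ cuts, ¬ SegmentsCross e f) (hP : P ∈ subPieces cuts Q) :
    P ⊆ innerPart Q e ∨ P ⊆ outerPart Q e := by
  by_contra! hc
  obtain ⟨hPQ, -, hside, hdiag⟩ := mem_subPieces.1 hP
  simp only [Finset.not_subset, mem_innerPart, mem_outerPart] at hc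
  obtain ⟨⟨l, hl, hl'⟩, k, hk, hk'⟩ := hc
  have hlQ := hPQ hl
  have hkQ := hPQ hk
  obtain ⟨hk1, hk2⟩ : e.1 < k ∧ k < e.2 := by grind
  have hl1 : l < e.1 ∨ e.2 < l := by grind
  have hout : ∀ s t, IsPolygonSide P (s, t) → SegmentsCross e (s, t) → False := by
    intro s t hst hx
    rcases hside _ hst with h | h
    · obtain ⟨-, -, -, h | h⟩ := h
      · have b1 := h _ hd.1
        have b2 := h _ hd.2.1
        unfold SegmentsCross at hx
        grind
      · have b1 := h _ hd.1
        have b2 := h _ hd.2.1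
        unfold SegmentsCross at hx
        grind
    · exact hcross _ h hx
  have h1 : e.1 ∈ P := by
    by_contra hn
    by_cases hp : ∃ p ∈ P, p < e.1
    · obtain ⟨p, hp, hpe⟩ := hp
      obtain ⟨s, t, hst, -, b1, b2, b3, -⟩ := exists_side_around hn hp hk hpe hk1
      exact hout s t hst (Or.inr ⟨b1, b2, b3.trans_lt hk2⟩)
    · push Not at hp
      have hl2 : e.2 < l := hl1.resolve_left (not_lt.2 (hp l hl))
      obtain ⟨s, t, hst, hb⟩ := exists_side_min_max hk hl (hk2.trans hl2)
      refine hout s t hst (Or.inl ⟨lt_of_le_of_ne (hp s hst.1) ?_, (hb k hk).1.trans_lt hk2,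
        hl2.trans_le (hb l hl).2⟩)
      intro h
      exact hn (h ▸ hst.1)
  have h2 : e.2 ∈ P := by
    by_contra hn
    by_cases hp : ∃ p ∈ P, e.2 < p
    · obtain ⟨p, hp, hpe⟩ := hp
      obtain ⟨s, t, hst, b0, b1, b2, -, -⟩ := exists_side_around hn hk hp hk2 hpe
      exact hout s t hst (Or.inl ⟨hk1.trans_le b0, b1, b2⟩)
    · push Not at hp
      have hl2 : l < e.1 := hl1.resolve_right (not_lt.2 (hp l hl))
      obtain ⟨s, t, hst, hb⟩ := exists_side_min_max hl hk (hl2.trans hk1)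
      refine hout s t hst (Or.inr ⟨(hb l hl).1.trans_lt hl2, hk1.trans_le (hb k hk).2,
        lt_of_le_of_ne (hp t hst.2.1) ?_⟩)
      intro h
      exact hn (h ▸ hst.2.1)
  exact hdiag e (isPolygonDiagonal_iff.2
    ⟨h1, h2, hd.2.2.1, ⟨k, hk, hk1, hk2⟩, l, hl, hl1⟩) he

theorem mem_subPieces_of_subset {cuts : Finset (Fin N × Fin N)} {Q R P : Finset (Fin N)}
    (hRQ : R ⊆ Q) (hR : ∀ s, IsPolygonSide R s → IsPolygonSide Q s ∨ s ∈ cuts) (hPR : P ⊆ R) :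
    P ∈ subPieces cuts Q ↔ P ∈ subPieces cuts R := by
  rw [mem_subPieces, mem_subPieces]
  constructor
  · rintro ⟨-, h2, h3, h4⟩
    exact ⟨hPR, h2, fun s hs => (h3 s hs).imp (fun h => h.mono hRQ (hPR hs.1) (hPR hs.2.1)) id, h4⟩
  · rintro ⟨-, h2, h3, h4⟩
    exact ⟨hPR.trans hRQ, h2, fun s hs => (h3 s hs).elim (fun h => hR s h) Or.inr, h4⟩

theorem subPieces_split {cuts : Finset (Fin N × Fin N)} {Q : Finset (Fin N)}
    {e : Fin N × Fin N} (he : e ∈ cuts) (hd : IsPolygonDiagonal Q e)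
    (hcross : ∀ f ∈ cuts, ¬ SegmentsCross e f) :
    subPieces cuts Q = subPieces cuts (innerPart Q e) ∪ subPieces cuts (outerPart Q e) := by
  have hin : ∀ s, IsPolygonSide (innerPart Q e) s → IsPolygonSide Q s ∨ s ∈ cuts :=
    fun s hs => (side_innerPart hd hs).imp_right fun h => by rwa [h]
  have hout : ∀ s, IsPolygonSide (outerPart Q e) s → IsPolygonSide Q s ∨ s ∈ cuts :=
    fun s hs => (side_outerPart hd hs).imp_right fun h => by rwa [h]
  ext P
  rw [Finset.mem_union]
  constructor
  · intro hP
    refine (subset_innerPart_or_outerPart he hd hcross hP).imp (fun h => ?_) (fun h => ?_)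
    · exact (mem_subPieces_of_subset (innerPart_subset Q e) hin h).1 hP
    · exact (mem_subPieces_of_subset (outerPart_subset Q e) hout h).1 hP
  · rintro (hP | hP)
    · exact (mem_subPieces_of_subset (innerPart_subset Q e) hin (mem_subPieces.1 hP).1).2 hP
    · exact (mem_subPieces_of_subset (outerPart_subset Q e) hout (mem_subPieces.1 hP).1).2 hP

theorem disjoint_subPieces_parts (cuts : Finset (Fin N × Fin N)) (Q : Finset (Fin N))
    (e : Fin N × Fin N) :
    Disjoint (subPieces cuts (innerPart Q e)) (subPieces cuts (outerPart Q e)) := by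
  rw [Finset.disjoint_left]
  intro P h1 h2
  rw [mem_subPieces] at h1 h2
  obtain ⟨k, hk, hk1, hk2⟩ := exists_mem_ne_ne h1.2.1 e.1 e.2
  have a1 := mem_innerPart.1 (h1.1 hk)
  have a2 := mem_outerPart.1 (h2.1 hk)
  grind

theorem subWeight_split {cuts : Finset (Fin N × Fin N)} {Q : Finset (Fin N)}
    {e : Fin N × Fin N} (he : e ∈ cuts) (hd : IsPolygonDiagonal Q e)
    (hcross : ∀ f ∈ cuts, ¬ SegmentsCross e f) (v : Fin N) :
    subWeight cuts Q v = subWeight cuts (innerPart Q e) v + subWeight cuts (outerPart Q e) v := by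
  rw [subWeight, subPieces_split he hd hcross, Finset.filter_union, Finset.card_union_of_disjoint]
  · rfl
  · exact Finset.disjoint_filter_filter (disjoint_subPieces_parts cuts Q e)

theorem subWeight_eq_zero {cuts : Finset (Fin N × Fin N)} {Q : Finset (Fin N)} {v : Fin N}
    (hv : v ∉ Q) : subWeight cuts Q v = 0 := by
  rw [subWeight, Finset.card_eq_zero, Finset.filter_eq_empty_iff]
  exact fun P hP h => hv ((mem_subPieces.1 hP).1 h.2)

theorem subWeight_eq_ite {cuts : Finset (Fin N × Fin N)} {Q : Finset (Fin N)} {v : Fin N}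
    (hQ : subPieces cuts Q = {Q}) :
    subWeight cuts Q v = if 3 ∣ Q.card ∧ v ∈ Q then 1 else 0 := by
  rw [subWeight, hQ, Finset.filter_singleton]
  split_ifs <;> simp

theorem three_le_card_parts {Q : Finset (Fin N)} {e : Fin N × Fin N}
    (hd : IsPolygonDiagonal Q e) :
    3 ≤ (innerPart Q e).card ∧ 3 ≤ (outerPart Q e).card := by
  obtain ⟨h1, h2, h3, ⟨k, hk, hk1, hk2⟩, l, hl, hl'⟩ := isPolygonDiagonal_iff.1 hd
  constructor
  · refine (Finset.two_lt_card).2 ⟨e.1, ?_, e.2, ?_, k, ?_, ?_⟩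
    · exact mem_innerPart.2 ⟨h1, le_rfl, h3.le⟩
    · exact mem_innerPart.2 ⟨h2, h3.le, le_rfl⟩
    · exact mem_innerPart.2 ⟨hk, hk1.le, hk2.le⟩
    · exact ⟨h3.ne, hk1.ne, hk2.ne'⟩
  · refine (Finset.two_lt_card).2 ⟨e.1, ?_, e.2, ?_, l, ?_, ?_⟩
    · exact mem_outerPart.2 ⟨h1, Or.inl le_rfl⟩
    · exact mem_outerPart.2 ⟨h2, Or.inr le_rfl⟩
    · exact mem_outerPart.2 ⟨hl, hl'.imp le_of_lt le_of_lt⟩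
    · grind

theorem card_parts_lt {Q : Finset (Fin N)} {e : Fin N × Fin N} (hd : IsPolygonDiagonal Q e) :
    (innerPart Q e).card < Q.card ∧ (outerPart Q e).card < Q.card := by
  obtain ⟨h1, h2, h3, ⟨k, hk, hk1, hk2⟩, l, hl, hl'⟩ := isPolygonDiagonal_iff.1 hd
  constructor
  · refine Finset.card_lt_card (Finset.ssubset_iff_subset_ne.2 ⟨innerPart_subset Q e, fun h => ?_⟩)
    have := mem_innerPart.1 (h ▸ hl)
    grind
  · refine Finset.card_lt_card (Finset.ssubset_iff_subset_ne.2 ⟨outerPart_subset Q e, fun h => ?_⟩)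
    have := mem_outerPart.1 (h ▸ hk)
    grind

/-- Induction along a dissection: cut a polygon in two as long as one of its diagonals is a cut. -/
theorem polygon_cut_induction (cuts : Finset (Fin N × Fin N)) {motive : Finset (Fin N) → Prop}
    (base : ∀ Q, 3 ≤ Q.card → (∀ e ∈ cuts, ¬ IsPolygonDiagonal Q e) → motive Q)
    (split : ∀ Q e, e ∈ cuts → IsPolygonDiagonal Q e → motive (innerPart Q e) →
      motive (outerPart Q e) → motive Q) (Q : Finset (Fin N)) (hQ : 3 ≤ Q.card) : motive Q := by
  induction hn : Q.card using Nat.strong_induction_on generalizing Q with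
  | _ n ih =>
    by_cases h : ∃ e ∈ cuts, IsPolygonDiagonal Q e
    · obtain ⟨e, he, hd⟩ := h
      have hc := card_parts_lt hd
      have h3 := three_le_card_parts hd
      exact split Q e he hd (ih _ (hn ▸ hc.1) _ h3.1 rfl) (ih _ (hn ▸ hc.2) _ h3.2 rfl)
    · push Not at h
      exact base Q hQ h

/-- A cut leaves each side of the polygon whole in one of the two parts, so the side can be followed
down to an uncut piece. -/
theorem exists_subPiece_side {cuts : Finset (Fin N × Fin N)}
    (hcross : ∀ e ∈ cuts, ∀ f ∈ cuts, ¬ SegmentsCross e f) {Q : Finset (Fin N)} (hQ : 3 ≤ Q.card)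
    {s : Fin N × Fin N} (hs : IsPolygonSide Q s) : ∃ P ∈ subPieces cuts Q, IsPolygonSide P s := by
  revert hs
  refine polygon_cut_induction cuts
    (motive := fun Q => IsPolygonSide Q s → ∃ P ∈ subPieces cuts Q, IsPolygonSide P s)
    (fun Q hQ h hs => ?_) (fun Q e he hd ih1 ih2 hs => ?_) Q hQ
  · exact ⟨Q, by simp [subPieces_eq_singleton hQ h], hs⟩
  · rw [subPieces_split he hd (hcross e he)]
    have : (s.1 ∈ innerPart Q e ∧ s.2 ∈ innerPart Q e) ∨
        (s.1 ∈ outerPart Q e ∧ s.2 ∈ outerPart Q e) := by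
      obtain ⟨h1, h2, h3, h4⟩ := hs
      have hlt := hd.2.2.1
      simp only [mem_innerPart, mem_outerPart, h1, h2, true_and]
      rcases h4 with h4 | h4
      · have a1 := h4 _ hd.1
        have a2 := h4 _ hd.2.1
        grind
      · have a1 := h4 _ hd.1
        have a2 := h4 _ hd.2.1
        grind
    rcases this with h | h
    · obtain ⟨P, hP, hPs⟩ := ih1 (hs.mono (innerPart_subset Q e) h.1 h.2)
      exact ⟨P, Finset.mem_union_left _ hP, hPs⟩
    · obtain ⟨P, hP, hPs⟩ := ih2 (hs.mono (outerPart_subset Q e) h.1 h.2)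
      exact ⟨P, Finset.mem_union_right _ hP, hPs⟩

end Polygon

/-! ### Matrix products of positive words -/

section Continuant

/-- The matrix `(x, -1; 1, 0)`. -/
def stepMatrix (x : ℤ) : Matrix (Fin 2) (Fin 2) ℤ := !![x, -1; 1, 0]

/-- The product of the matrices `stepMatrix x`, `x ∈ w`, in reverse order. -/
def contProd (w : List ℤ) : Matrix (Fin 2) (Fin 2) ℤ := ((w.map stepMatrix).reverse).prod

theorem continuantMatrix_eq_contProd {n : ℕ} (a : Fin n → ℤ) :
    continuantMatrix a = contProd (List.ofFn a) := by
  rw [continuantMatrix, contProd, List.map_ofFn]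
  rfl

@[simp] theorem contProd_nil : contProd [] = 1 := rfl

@[simp] theorem contProd_cons (x : ℤ) (w : List ℤ) :
    contProd (x :: w) = contProd w * stepMatrix x := by
  simp [contProd]

@[simp] theorem contProd_append (v w : List ℤ) :
    contProd (v ++ w) = contProd w * contProd v := by
  simp [contProd]

/-- Equality up to sign. -/
def EqUpToSign {M : Type*} [Neg M] (A B : M) : Prop := A = B ∨ A = -B

namespace EqUpToSign

variable {R : Type*} [Ring R] {A B C : R}

theorem refl (A : R) : EqUpToSign A A := Or.inl rfl

theorem symm (h : EqUpToSign A B) : EqUpToSign B A := by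
  rcases h with rfl | rfl
  · exact Or.inl rfl
  · exact Or.inr (neg_neg B).symm

theorem trans (h : EqUpToSign A B) (h' : EqUpToSign B C) : EqUpToSign A C := by
  rcases h with rfl | rfl <;> rcases h' with rfl | rfl
  · exact Or.inl rfl
  · exact Or.inr rfl
  · exact Or.inr rfl
  · exact Or.inl (neg_neg C)

theorem mul_left (h : EqUpToSign A B) (C : R) : EqUpToSign (C * A) (C * B) := by
  rcases h with rfl | rfl
  · exact Or.inl rfl
  · exact Or.inr (mul_neg C B)

theorem mul_right (h : EqUpToSign A B) (C : R) : EqUpToSign (A * C) (B * C) := by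
  rcases h with rfl | rfl
  · exact Or.inl rfl
  · exact Or.inr (neg_mul B C)

end EqUpToSign

theorem contProd_replicate (m : ℕ) (x : ℤ) :
    contProd (List.replicate m x) = stepMatrix x ^ m := by
  simp [contProd]

theorem stepMatrix_one_pow_three : stepMatrix 1 ^ 3 = -1 := by
  simp only [stepMatrix]
  decide

theorem stepMatrix_zero_pow_four : stepMatrix 0 ^ 4 = 1 := by
  simp only [stepMatrix]
  decide

theorem eqUpToSign_stepMatrix_one_pow (m : ℕ) :
    EqUpToSign (stepMatrix 1 ^ m) (stepMatrix 1 ^ (m % 3)) := by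
  conv_lhs => rw [← Nat.div_add_mod m 3]
  rw [pow_add, pow_mul, stepMatrix_one_pow_three]
  rcases neg_one_pow_eq_or (Matrix (Fin 2) (Fin 2) ℤ) (m / 3) with h | h <;> rw [h]
  · exact Or.inl (one_mul _)
  · exact Or.inr (neg_one_mul _)

/-- Two polygons glued along a side. -/
theorem contProd_glue {p q x y : ℤ} {u v w : List ℤ}
    (h : EqUpToSign (contProd (p :: v ++ [q])) 1) :
    EqUpToSign (contProd (u ++ (p + x) :: v ++ (q + y) :: w)) (contProd (u ++ x :: y :: w)) := by
  have key : EqUpToSign (stepMatrix (q + y) * contProd v * stepMatrix (p + x))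
      (stepMatrix y * stepMatrix x) := by
    -- With `J = (0, 1; -1, 0)`, the added weights split off as `C(q + y) = C(y) J C(q)` and `C(p +
    -- x) = C(p) J C(x)`, up to the grouping in `e2` and `e4`. This isolates the product of the
    -- glued polygon, and `J ^ 2 = -1` remains.
    have e1 : stepMatrix (q + y) = stepMatrix y * !![1, 0; -q, 1] := by
      simp [stepMatrix]; ring
    have e2 : stepMatrix (p + x) = !![1, p; 0, 1] * stepMatrix x := by
      simp [stepMatrix]; ring
    have e3 : !![1, 0; -q, 1] = !![0, 1; -1, 0] * stepMatrix q := by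
      simp [stepMatrix]
    have e4 : !![1, p; 0, 1] = stepMatrix p * !![0, 1; -1, 0] := by
      simp [stepMatrix]
    have e5 : (!![0, 1; -1, 0] * !![0, 1; -1, 0] : Matrix (Fin 2) (Fin 2) ℤ) = -1 := by decide
    simp only [contProd_append, contProd_cons, contProd_nil, one_mul, List.cons_append] at h
    have h' := ((h.mul_left (stepMatrix y * !![0, 1; -1, 0])).mul_right
      (!![0, 1; -1, 0] * stepMatrix x))
    rw [e1, e2, e3, e4]
    have e6 : stepMatrix y * !![0, 1; -1, 0] * 1 * (!![0, 1; -1, 0] * stepMatrix x) =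
        -(stepMatrix y * stepMatrix x) := by
      rw [mul_one, mul_assoc, ← mul_assoc !![0, 1; -1, 0], e5]; simp
    rw [e6] at h'
    have h'' : EqUpToSign (-(stepMatrix y * stepMatrix x)) (stepMatrix y * stepMatrix x) :=
      Or.inr rfl
    simpa only [mul_assoc] using h'.trans h''
  simp only [contProd_append, contProd_cons, List.append_assoc, List.cons_append]
  simpa only [mul_assoc] using (key.mul_left (contProd w)).mul_right (contProd u)

theorem eqUpToSign_contProd_ear {b : ℕ} (hb : b % 3 = 1) :
    EqUpToSign (contProd (1 :: List.replicate b 1 ++ [1])) 1 := by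
  have : (1 :: List.replicate b (1 : ℤ) ++ [1]) = List.replicate (b + 2) 1 := by
    rw [← List.replicate_succ, ← List.replicate_succ']
  rw [this, contProd_replicate]
  have h := eqUpToSign_stepMatrix_one_pow (b + 2)
  rwa [show (b + 2) % 3 = 0 by omega, pow_zero] at h

theorem exists_eq_replicate_one_append (w : List ℤ) (hw : ∀ c ∈ w, 0 < c) :
    ∃ m, w = List.replicate m 1 ∨ ∃ c t, 2 ≤ c ∧ w = List.replicate m 1 ++ c :: t := by
  induction w with
  | nil => exact ⟨0, Or.inl rfl⟩
  | cons d t ih =>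
    simp only [List.mem_cons, forall_eq_or_imp] at hw
    by_cases hd : d = 1
    · subst hd
      obtain ⟨m, h | ⟨c, t', hc, h⟩⟩ := ih hw.2
      · exact ⟨m + 1, Or.inl (by rw [h, List.replicate_succ])⟩
      · exact ⟨m + 1, Or.inr ⟨c, t', hc, by rw [h, List.replicate_succ, List.cons_append]⟩⟩
    · exact ⟨0, Or.inr ⟨d, t, by omega, rfl⟩⟩

/-- The word has an inner run of ones, of length `1` modulo `3`, between larger entries. -/
def HasEar (w : List ℤ) : Prop :=
  ∃ (u : List ℤ) (p : ℤ) (b : ℕ) (q : ℤ) (v : List ℤ), 2 ≤ p ∧ 2 ≤ q ∧ b % 3 = 1 ∧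
    w = u ++ p :: List.replicate b 1 ++ q :: v

theorem HasEar.append_left {w : List ℤ} (h : HasEar w) (t : List ℤ) : HasEar (t ++ w) := by
  obtain ⟨u, p, b, q, v, hp, hq, hb, rfl⟩ := h
  exact ⟨t ++ u, p, b, q, v, hp, hq, hb, by simp⟩

theorem mulVec_stepMatrix (a y x : ℤ) : (stepMatrix a).mulVec ![y, x] = ![a * y - x, y] := by
  ext i; fin_cases i <;> simp [stepMatrix, Matrix.mulVec, dotProduct, Fin.sum_univ_two]; ring

theorem EqUpToSign.mulVec {A B : Matrix (Fin 2) (Fin 2) ℤ} (h : EqUpToSign A B) (v : Fin 2 → ℤ) :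
    EqUpToSign (A.mulVec v) (B.mulVec v) := by
  rcases h with rfl | rfl
  · exact Or.inl rfl
  · exact Or.inr (Matrix.neg_mulVec v B)

theorem EqUpToSign.mulVec_right {v w : Fin 2 → ℤ} (h : EqUpToSign v w)
    (A : Matrix (Fin 2) (Fin 2) ℤ) : EqUpToSign (A.mulVec v) (A.mulVec w) := by
  rcases h with rfl | rfl
  · exact Or.inl rfl
  · exact Or.inr (Matrix.mulVec_neg w A)

/-- The cone `1 ≤ x < y` is preserved, up to sign, by words without ears, except for a last run of
ones; moreover `y` increases. -/
theorem hasEar_or_mulVec_contProd (t : List ℤ) (ht : ∀ c ∈ t, 0 < c) (b : ℤ) (hb : 2 ≤ b)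
    (y x : ℤ) (hx : 1 ≤ x) (hxy : x < y) :
    HasEar (b :: t) ∨ ∃ s, ∃ Y X : ℤ, 1 ≤ X ∧ X < Y ∧
      EqUpToSign ((contProd t).mulVec ![y, x]) ((stepMatrix 1 ^ s).mulVec ![Y, X]) ∧
      (y < Y ∨ Y = y ∧ X = x ∧ t = List.replicate s 1) := by
  induction hn : t.length using Nat.strong_induction_on generalizing t b y x with
  | _ n ih =>
    obtain ⟨m, h | ⟨c, r, hc, h⟩⟩ := exists_eq_replicate_one_append t ht
    · right
      exact ⟨m, y, x, hx, hxy, by rw [h, contProd_replicate]; exact .refl _, .inr ⟨rfl, rfl, h⟩⟩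
    · by_cases hm : m % 3 = 1
      · exact Or.inl ⟨[], b, m, c, r, hb, hc, hm, by simp [h]⟩
      · have hr : ∀ d ∈ r, 0 < d := fun d hd => ht d (by simp [h, hd])
        have hlen : r.length < n := by rw [← hn, h]; simp; omega
        have key : ∃ y' x', 1 ≤ x' ∧ x' < y' ∧ y < y' ∧
            EqUpToSign ((stepMatrix c * stepMatrix 1 ^ m).mulVec ![y, x]) ![y', x'] := by
          have h1 := ((eqUpToSign_stepMatrix_one_pow m).mul_left (stepMatrix c)).mulVec ![y, x]
          have hm' : m % 3 = 0 ∨ m % 3 = 2 := by omega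
          -- The block `1^m c` sends `(y, x)` to `±(c y - x, y)` if `m ≡ 0` and to `±(y + (c - 1) x,
          -- x)` if `m ≡ 2` modulo 3. Both stay in the cone with a larger first coordinate; `m ≡ 1`
          -- was the ear.
          rcases hm' with h0 | h0 <;> rw [h0] at h1
          · refine ⟨c * y - x, y, by omega, by nlinarith, by nlinarith, ?_⟩
            rwa [pow_zero, mul_one, mulVec_stepMatrix] at h1
          · refine ⟨y + (c - 1) * x, x, hx, by nlinarith, by nlinarith, h1.trans ?_⟩
            rw [pow_two, ← Matrix.mulVec_mulVec, ← Matrix.mulVec_mulVec, mulVec_stepMatrix,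
              mulVec_stepMatrix, mulVec_stepMatrix]
            right
            ext i; fin_cases i <;> simp; ring
        obtain ⟨y', x', hx', hxy', hyy', hv⟩ := key
        rcases ih _ hlen r hr c hc y' x' hx' hxy' rfl with he | ⟨s, Y, X, h1, h2, h3, h4⟩
        · left
          have := he.append_left (b :: List.replicate m 1)
          simpa [h] using this
        · right
          refine ⟨s, Y, X, h1, h2, ?_, Or.inl (by omega)⟩
          refine EqUpToSign.trans ?_ h3
          have := hv.mulVec_right (contProd r)
          rw [h, contProd_append, contProd_cons, contProd_replicate, mul_assoc,
            ← Matrix.mulVec_mulVec]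
          exact this

/-- The left side is `(Y, X)`, `(Y - X, Y)` or `(-X, Y - X)` for `s = 0, 1, 2`, never with a zero
coordinate. The right side is `(0, 1)`, `(-1, 1)` or `(-1, 0)` for `r = 0, 1, 2`. Only the signs for
`s = 2`, `r = 1` agree. -/
theorem cone_mod_three {r s : ℕ} {Y X : ℤ} (hX : 1 ≤ X) (hXY : X < Y)
    (h : EqUpToSign ((stepMatrix 1 ^ s).mulVec ![Y, X])
      ((matrixS * stepMatrix 1 ^ r).mulVec ![1, 0])) (hr : r < 3) (hs : s < 3) :
    r = 1 ∧ s = 2 ∧ Y = 2 ∧ X = 1 := by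
  have hS : ∀ a b : ℤ, matrixS.mulVec ![a, b] = ![-b, a] := fun a b => by
    ext i; fin_cases i <;> simp [matrixS]
  interval_cases r <;> interval_cases s <;>
    simp only [pow_zero, pow_one, pow_two, ← Matrix.mulVec_mulVec, mulVec_stepMatrix, hS,
      Matrix.one_mulVec, EqUpToSign, funext_iff, Fin.forall_fin_two, Pi.neg_apply,
      Matrix.cons_val_zero, Matrix.cons_val_one] at h <;> omega

/-- After the initial run of ones, the first larger entry `c` sends `(1, 0)` to `(c, 1)`, which lies
in the cone. Without ears the first coordinate can only grow from `c ≥ 2`, whereas the product `±S`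
forces the final value 2; so `c = 2` and only ones follow. -/
theorem hasEar_or_eq_of_contProd_eq (w : List ℤ) (hw : ∀ c ∈ w, 0 < c)
    (h : EqUpToSign (contProd w) matrixS) :
    HasEar w ∨ ∃ r s, r % 3 = 2 ∧ s % 3 = 2 ∧
      w = List.replicate r 1 ++ 2 :: List.replicate s 1 := by
  obtain ⟨m, rfl | ⟨c, t, hc, rfl⟩⟩ := exists_eq_replicate_one_append w hw
  · exfalso
    rw [contProd_replicate] at h
    have h' := (eqUpToSign_stepMatrix_one_pow m).symm.trans h
    have : m % 3 < 3 := Nat.mod_lt _ (by norm_num)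
    revert h'
    generalize m % 3 = k at *
    interval_cases k <;> unfold EqUpToSign stepMatrix matrixS <;> decide
  · have ht : ∀ d ∈ t, 0 < d := fun d hd => hw d (by simp [hd])
    rcases hasEar_or_mulVec_contProd t ht c hc c 1 le_rfl (by omega) with
      he | ⟨s, Y, X, h1, h2, h3, h4⟩
    · exact Or.inl (he.append_left _)
    · right
      set R := stepMatrix 1 with hR
      -- `R ^ k` inverts the initial run `R ^ m` up to sign, which moves that run to the side of
      -- `S`.
      obtain ⟨k, hk, hk3, hkm⟩ : ∃ k, EqUpToSign (R ^ m * R ^ k) 1 ∧ k < 3 ∧ (m + k) % 3 = 0 := by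
        refine ⟨(3 - m % 3) % 3, ?_, Nat.mod_lt _ (by norm_num), by omega⟩
        have := eqUpToSign_stepMatrix_one_pow (m + (3 - m % 3) % 3)
        rwa [show (m + (3 - m % 3) % 3) % 3 = 0 by omega, pow_add, pow_zero] at this
      rw [contProd_append, contProd_cons, contProd_replicate] at h
      have h5 : EqUpToSign (contProd t * stepMatrix c) (matrixS * R ^ k) := by
        have a1 := h.mul_right (R ^ k)
        have a2 := hk.mul_left (contProd t * stepMatrix c)
        rw [mul_one, ← mul_assoc] at a2
        exact a2.symm.trans a1
      have h6 := h5.mulVec ![1, 0]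
      rw [← Matrix.mulVec_mulVec, mulVec_stepMatrix] at h6
      simp only [mul_one, sub_zero] at h6
      have h7 := h3.symm.trans h6
      have h8 := ((eqUpToSign_stepMatrix_one_pow s).symm.mulVec ![Y, X]).trans h7
      obtain ⟨b1, b2, b3, b4⟩ := cone_mod_three h1 h2 h8 hk3 (Nat.mod_lt _ (by norm_num))
      rcases h4 with h4 | ⟨h4, -, h4'⟩
      · omega
      · exact ⟨m, s, by omega, b2, by rw [h4', show c = 2 by omega]⟩

end Continuant

/-! ### Weights of a dissection as a word, and dissections built from words -/

section Quiddity

variable {N : ℕ}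

theorem exists_append_of_lt {L : List (Fin N)} (hL : L.Pairwise (· < ·)) {u v : Fin N}
    (hu : u ∈ L) (hv : v ∈ L) (huv : u < v) : ∃ A B C, L = A ++ u :: B ++ v :: C := by
  obtain ⟨A, T, rfl⟩ := List.append_of_mem hu
  rw [List.pairwise_append] at hL
  have hvT : v ∈ T := by
    rcases List.mem_append.1 hv with h | h
    · exact absurd (hL.2.2 v h u (by simp)) (not_lt.2 huv.le)
    · exact (List.mem_cons.1 h).resolve_left huv.ne'
  obtain ⟨B, C, rfl⟩ := List.append_of_mem hvT
  exact ⟨A, B, C, by simp⟩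

theorem sorted_append_iff {A B C : List (Fin N)} {u v : Fin N}
    (hL : (A ++ u :: B ++ v :: C).Pairwise (· < ·)) :
    u < v ∧ (∀ k ∈ A, k < u) ∧ (∀ k ∈ B, u < k ∧ k < v) ∧ (∀ k ∈ C, v < k) ∧
      (u :: B ++ [v]).Pairwise (· < ·) ∧ (A ++ u :: v :: C).Pairwise (· < ·) := by
  simp only [List.pairwise_append, List.pairwise_cons, List.mem_cons, List.mem_append,
    List.append_assoc, List.cons_append] at *
  grind

theorem innerPart_toFinset {A B C : List (Fin N)} {u v : Fin N}
    (hL : (A ++ u :: B ++ v :: C).Pairwise (· < ·)) :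
    innerPart (A ++ u :: B ++ v :: C).toFinset (u, v) = (u :: B ++ [v]).toFinset := by
  obtain ⟨h1, h2, h3, h4, -⟩ := sorted_append_iff hL
  ext k
  simp only [mem_innerPart, List.mem_toFinset, List.mem_append, List.mem_cons]
  grind

theorem outerPart_toFinset {A B C : List (Fin N)} {u v : Fin N}
    (hL : (A ++ u :: B ++ v :: C).Pairwise (· < ·)) :
    outerPart (A ++ u :: B ++ v :: C).toFinset (u, v) = (A ++ u :: v :: C).toFinset := by
  obtain ⟨h1, h2, h3, h4, -⟩ := sorted_append_iff hL
  ext k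
  simp only [mem_outerPart, List.mem_toFinset, List.mem_append, List.mem_cons]
  grind

/-- Induction along the cuts: weights add over the two parts and only the end points of the cut
belong to both, which is the situation of `contProd_glue`. -/
theorem contProd_subWeight {cuts : Finset (Fin N × Fin N)}
    (hcross : ∀ e ∈ cuts, ∀ f ∈ cuts, ¬ SegmentsCross e f) (Q : Finset (Fin N)) (hQ : 3 ≤ Q.card)
    (hpieces : ∀ P ∈ subPieces cuts Q, 3 ∣ P.card ∨ P.card = 4) (L : List (Fin N))
    (hL : L.Pairwise (· < ·)) (hLQ : L.toFinset = Q) :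
    EqUpToSign (contProd (L.map fun v => (subWeight cuts Q v : ℤ))) 1 := by
  revert hpieces L
  refine polygon_cut_induction cuts (motive := fun Q =>
    (∀ P ∈ subPieces cuts Q, 3 ∣ P.card ∨ P.card = 4) → ∀ L : List (Fin N),
      L.Pairwise (· < ·) → L.toFinset = Q →
      EqUpToSign (contProd (L.map fun v => (subWeight cuts Q v : ℤ))) 1)
    (fun Q hQ hd hp L hL hLQ => ?_) (fun Q e he hd ih1 ih2 hp L hL hLQ => ?_) Q hQ
  · have hs := subPieces_eq_singleton hQ hd
    have hlen : L.length = Q.card := by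
      rw [← hLQ, List.toFinset_card_of_nodup (hL.imp ne_of_lt)]
    have hmap : L.map (fun v => (subWeight cuts Q v : ℤ)) =
        List.replicate Q.card (if 3 ∣ Q.card then 1 else 0) := by
      rw [List.eq_replicate_iff, List.length_map]
      refine ⟨hlen, fun b hb => ?_⟩
      obtain ⟨v, hv, rfl⟩ := List.mem_map.1 hb
      have hvQ : v ∈ Q := by rw [← hLQ]; simpa using hv
      rw [subWeight_eq_ite hs]
      simp [hvQ]
    rw [hmap, contProd_replicate]
    rcases hp Q (by simp [hs]) with h | h
    · rw [if_pos h]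
      have := eqUpToSign_stepMatrix_one_pow Q.card
      rwa [Nat.mod_eq_zero_of_dvd h, pow_zero] at this
    · rw [h, if_neg (by norm_num), stepMatrix_zero_pow_four]
      exact .refl _
  · obtain ⟨u, v⟩ := e
    have hsplit := subPieces_split he hd (hcross _ he)
    obtain ⟨A, B, C, rfl⟩ := exists_append_of_lt hL (u := u) (v := v)
      (by simpa [← hLQ] using hd.1) (by simpa [← hLQ] using hd.2.1) hd.2.2.1
    obtain ⟨h1, h2, h3, h4, hin, hout⟩ := sorted_append_iff hL
    have b1 := ih1 (fun P hP => hp P (by rw [hsplit]; exact Finset.mem_union_left _ hP)) _ hin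
      (by rw [← hLQ, innerPart_toFinset hL])
    have b2 := ih2 (fun P hP => hp P (by rw [hsplit]; exact Finset.mem_union_right _ hP)) _ hout
      (by rw [← hLQ, outerPart_toFinset hL])
    have hA : ∀ k ∈ A, subWeight cuts Q k = subWeight cuts (outerPart Q (u, v)) k := by
      intro k hk
      rw [subWeight_split he hd (hcross _ he), subWeight_eq_zero, zero_add]
      exact fun hc => absurd (h2 k hk) (not_lt.2 (mem_innerPart.1 hc).2.1)
    have hC : ∀ k ∈ C, subWeight cuts Q k = subWeight cuts (outerPart Q (u, v)) k := by
      intro k hk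
      rw [subWeight_split he hd (hcross _ he), subWeight_eq_zero, zero_add]
      exact fun hc => absurd (h4 k hk) (not_lt.2 (mem_innerPart.1 hc).2.2)
    have hB : ∀ k ∈ B, subWeight cuts Q k = subWeight cuts (innerPart Q (u, v)) k := by
      intro k hk
      rw [subWeight_split he hd (hcross _ he), subWeight_eq_zero (Q := outerPart Q _), add_zero]
      have := h3 k hk
      exact fun hc => (mem_outerPart.1 hc).2.elim (not_le.2 this.1) (not_le.2 this.2)
    simp only [List.map_append, List.map_cons, List.map_nil] at b1 b2 ⊢
    have hA' : A.map (fun k => (subWeight cuts Q k : ℤ)) =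
        A.map fun k => (subWeight cuts (outerPart Q (u, v)) k : ℤ) :=
      List.map_congr_left fun k hk => by rw [hA k hk]
    have hB' : B.map (fun k => (subWeight cuts Q k : ℤ)) =
        B.map fun k => (subWeight cuts (innerPart Q (u, v)) k : ℤ) :=
      List.map_congr_left fun k hk => by rw [hB k hk]
    have hC' : C.map (fun k => (subWeight cuts Q k : ℤ)) =
        C.map fun k => (subWeight cuts (outerPart Q (u, v)) k : ℤ) :=
      List.map_congr_left fun k hk => by rw [hC k hk]
    rw [hA', hB', hC', subWeight_split he hd (hcross _ he) u,
      subWeight_split he hd (hcross _ he) v, Nat.cast_add, Nat.cast_add]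
    exact (contProd_glue b1).trans b2

/-- The cuts `cuts` of the polygon with vertices `z`, `l` realize the weights `a` on `l`, and the
quadrilateral is `z, f, x, t` with `f` and `t` the first and the last vertex of `l`. -/
structure Realizes (z f x t : Fin N) (cuts : Finset (Fin N × Fin N)) (l : List (Fin N))
    (a : Fin N → ℤ) : Prop where
  isDiagonal : ∀ e ∈ cuts, IsPolygonDiagonal (z :: l).toFinset e
  noncrossing : ∀ e ∈ cuts, ∀ g ∈ cuts, ¬ SegmentsCross e g
  quad_mem : {z, f, x, t} ∈ subPieces cuts (z :: l).toFinset
  dvd_card : ∀ P ∈ subPieces cuts (z :: l).toFinset, P ≠ {z, f, x, t} → 3 ∣ P.card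
  subWeight_eq : ∀ v ∈ l, (subWeight cuts (z :: l).toFinset v : ℤ) = a v
  bounds : ∀ v ∈ l, f ≤ v ∧ v ≤ t

theorem card_quad {z f x t : Fin N} (h1 : z < f) (h2 : f < x) (h3 : x < t) :
    ({z, f, x, t} : Finset (Fin N)).card = 4 := by
  rw [Finset.card_insert_of_notMem, Finset.card_insert_of_notMem, Finset.card_pair h3.ne]
  · simp only [Finset.mem_insert, Finset.mem_singleton]; grind
  · simp only [Finset.mem_insert, Finset.mem_singleton]; grind

theorem realizes_quad {z f x t : Fin N} (h1 : z < f) (h2 : f < x) (h3 : x < t) :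
    Realizes z f x t ∅ [f, x, t] 0 := by
  have hc := card_quad h1 h2 h3
  have hq : [z, f, x, t].toFinset = {z, f, x, t} := by simp
  have hs : subPieces ∅ [z, f, x, t].toFinset = {{z, f, x, t}} := by
    rw [subPieces_eq_singleton (by rw [hq]; omega) (by simp), hq]
  refine ⟨by simp, by simp, by rw [hs]; simp, fun P hP hne => ?_, fun v hv => ?_, fun v hv => ?_⟩
  · rw [hs, Finset.mem_singleton] at hP
    exact absurd hP hne
  · rw [subWeight, hs, Finset.filter_singleton, hc]
    simp
  · simp only [List.mem_cons, List.not_mem_nil, or_false] at hv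
    grind

/-- The new cut is a side of the old polygon, so the old pieces are unchanged, and the ear is a
single new piece with `B.length + 2` vertices, a multiple of 3. Since `u` and `v` are consecutive in
the list without `z`, no ear is ever put on the two sides at the notch. -/
theorem Realizes.ear {z f x t : Fin N} {cuts : Finset (Fin N × Fin N)} {A B C : List (Fin N)}
    {u v : Fin N} {a b : Fin N → ℤ} (h : Realizes z f x t cuts (A ++ u :: v :: C) a)
    (hL : (z :: (A ++ u :: B ++ v :: C)).Pairwise (· < ·)) (hB : B.length % 3 = 1)
    (hAC : ∀ k ∈ A ++ C, b k = a k) (hbu : b u = a u + 1) (hbv : b v = a v + 1)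
    (hbB : ∀ k ∈ B, b k = 1) :
    Realizes z f x t (insert (u, v) cuts) (A ++ u :: B ++ v :: C) b := by
  have hL' : (((z :: A) ++ u :: B) ++ v :: C).Pairwise (· < ·) := by simpa using hL
  obtain ⟨huv, hAu, hBuv, hCv, hin, hout⟩ := sorted_append_iff hL'
  set Q := (z :: (A ++ u :: B ++ v :: C)).toFinset with hQ
  set Q' := (z :: (A ++ u :: v :: C)).toFinset with hQ'
  have hinner : innerPart Q (u, v) = (u :: B ++ [v]).toFinset := by
    rw [← innerPart_toFinset hL']; simp [hQ]
  have houter : outerPart Q (u, v) = Q' := by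
    rw [hQ', ← List.cons_append, ← outerPart_toFinset hL']; simp [hQ]
  have hsub : Q' ⊆ Q := houter ▸ outerPart_subset Q _
  have hzu : z < u := hAu z (by simp)
  obtain ⟨k, hk⟩ : ∃ k, k ∈ B := List.exists_mem_of_length_pos (by omega)
  have hd : IsPolygonDiagonal Q (u, v) := by
    refine isPolygonDiagonal_iff.2 ⟨by simp [hQ], by simp [hQ], huv, ⟨k, by simp [hQ, hk],
      hBuv k hk⟩, z, by simp [hQ], Or.inl hzu⟩
  have hmemQ' : ∀ k ∈ Q', k ≤ u ∨ v ≤ k := fun k hk => by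
    rw [← houter, mem_outerPart] at hk
    exact hk.2
  have hside : IsPolygonSide Q' (u, v) :=
    ⟨by simp [hQ'], by simp [hQ'], huv, Or.inl hmemQ'⟩
  have hcr : ∀ e ∈ cuts, ¬ SegmentsCross (u, v) e ∧ ¬ SegmentsCross e (u, v) := fun e he => by
    have a1 := hmemQ' _ (h.isDiagonal e he).1
    have a2 := hmemQ' _ (h.isDiagonal e he).2.1
    unfold SegmentsCross
    grind
  have hcross : ∀ e ∈ insert (u, v) cuts, ∀ g ∈ insert (u, v) cuts, ¬ SegmentsCross e g := by
    simp only [Finset.mem_insert]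
    rintro e (rfl | he) g (rfl | hg)
    · simp [SegmentsCross]
    · exact (hcr g hg).1
    · exact (hcr e he).2
    · exact h.noncrossing e he g hg
  have hmem : (u, v) ∈ insert (u, v) cuts := Finset.mem_insert_self _ _
  have hcardin : (innerPart Q (u, v)).card = B.length + 2 := by
    rw [hinner, List.toFinset_card_of_nodup (hin.imp ne_of_lt)]; simp
  have hpin : subPieces (insert (u, v) cuts) (innerPart Q (u, v)) = {innerPart Q (u, v)} := by
    refine subPieces_eq_singleton (by omega) fun e he hde => ?_
    obtain ⟨b1, b2, b3, ⟨m, hm, hm1, hm2⟩, n, hn, hn'⟩ := isPolygonDiagonal_iff.1 hde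
    simp only [mem_innerPart] at b1 b2 hm hn
    rcases Finset.mem_insert.1 he with rfl | he
    · grind
    · have a1 := hmemQ' _ (h.isDiagonal e he).1
      have a2 := hmemQ' _ (h.isDiagonal e he).2.1
      grind
  have hpout : subPieces (insert (u, v) cuts) (outerPart Q (u, v)) = subPieces cuts Q' := by
    rw [houter]
    ext P
    rw [mem_subPieces, mem_subPieces]
    refine and_congr_right fun hPQ => and_congr_right fun _ => and_congr ?_ ?_
    · refine forall₂_congr fun e _ => ?_
      rw [Finset.mem_insert]
      constructor
      · rintro (h | rfl | h)
        exacts [Or.inl h, Or.inl hside, Or.inr h]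
      · exact Or.imp_right Or.inr
    · refine forall₂_congr fun e he => ?_
      rw [Finset.mem_insert, not_or]
      refine and_iff_right ?_
      rintro rfl
      exact he.2.2.2 (hside.mono hPQ he.1 he.2.1)
  have hsplit := subPieces_split hmem hd (hcross _ hmem)
  rw [hpin, hpout] at hsplit
  have hw : ∀ k, subWeight (insert (u, v) cuts) Q k =
      (if k ∈ innerPart Q (u, v) then 1 else 0) + subWeight cuts Q' k := fun k => by
    rw [subWeight_split hmem hd (hcross _ hmem), subWeight_eq_ite hpin, hcardin]
    congr 1
    · simp [show 3 ∣ B.length + 2 by omega]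
    · rw [subWeight, subWeight, hpout]
  have hbu' := h.bounds u (by simp)
  have hbv' := h.bounds v (by simp)
  refine ⟨?_, hcross, ?_, ?_, ?_, ?_⟩
  · intro e he
    rcases Finset.mem_insert.1 he with rfl | he
    · exact hd
    · exact (h.isDiagonal e he).mono hsub
  · rw [hsplit]
    exact Finset.mem_union_right _ h.quad_mem
  · intro P hP hne
    rw [hsplit, Finset.mem_union, Finset.mem_singleton] at hP
    rcases hP with rfl | hP
    · rw [hcardin]; omega
    · exact h.dvd_card P hP hne
  · intro k hk
    rw [hw, hinner]
    have hcases : k ∈ A ++ C ∨ k = u ∨ k = v ∨ k ∈ B := by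
      simp only [List.mem_append, List.mem_cons] at hk ⊢; tauto
    rcases hcases with hk | rfl | rfl | hk
    · have : k ∉ (u :: B ++ [v]).toFinset := by
        rw [← hinner, mem_innerPart]
        rcases List.mem_append.1 hk with hk | hk
        · have := hAu k (by simp [hk]); grind
        · have := hCv k hk; grind
      rw [if_neg this, zero_add, h.subWeight_eq k (by simp at hk ⊢; tauto), hAC k hk]
    · rw [if_pos (by simp), Nat.cast_add, h.subWeight_eq k (by simp), hbu]
      push_cast; ring
    · rw [if_pos (by simp), Nat.cast_add, h.subWeight_eq k (by simp), hbv]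
      push_cast; ring
    · rw [if_pos (by simp [hk]), subWeight_eq_zero, hbB k hk]
      · simp
      · intro hc
        have := hBuv k hk
        exact (hmemQ' k hc).elim (not_le.2 this.1) (not_le.2 this.2)
  · intro k hk
    have hcases : k ∈ A ++ u :: v :: C ∨ k ∈ B := by
      simp only [List.mem_append, List.mem_cons] at hk ⊢; tauto
    rcases hcases with hk | hk
    · exact h.bounds k hk
    · have := hBuv k hk
      exact ⟨hbu'.1.trans this.1.le, this.2.le.trans hbv'.2⟩

theorem exists_realizes (z : Fin N) (l : List (Fin N)) (hl : (z :: l).Pairwise (· < ·))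
    (a : Fin N → ℤ) (ha : ∀ v ∈ l, 0 < a v) (h : EqUpToSign (contProd (l.map a)) matrixS) :
    ∃ f x t cuts, z < f ∧ f < x ∧ x < t ∧ Realizes z f x t cuts l a ∧
      (f, x) ∈ cuts ∧ (x, t) ∈ cuts := by
  induction hn : l.length using Nat.strong_induction_on generalizing l a with
  | _ n ih =>
    rcases hasEar_or_eq_of_contProd_eq (l.map a) (by simpa using ha) h with
      ⟨w, p, b, q, w', hp, hq, hb, he⟩ | ⟨r, s, hr, hs, he⟩
    · obtain ⟨A', C', rfl, hA', hC'⟩ := List.map_eq_append_iff.1 he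
      obtain ⟨A, B', rfl, hA, hB'⟩ := List.map_eq_append_iff.1 hA'
      obtain ⟨u, B, rfl, hu, hB⟩ := List.map_eq_cons_iff.1 hB'
      obtain ⟨v, C, rfl, hv, hC⟩ := List.map_eq_cons_iff.1 hC'
      have hL' : (((z :: A) ++ u :: B) ++ v :: C).Pairwise (· < ·) := by simpa using hl
      obtain ⟨huv, hAu, hBuv, hCv, hin, hout⟩ := sorted_append_iff hL'
      rw [List.eq_replicate_iff, List.length_map] at hB
      have hB1 : ∀ k ∈ B, a k = 1 := fun k hk => hB.2 _ (List.mem_map_of_mem hk)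
      -- Weights left after removal of the ear; they stay positive because both neighbours of the
      -- run are at least 2.
      set a' : Fin N → ℤ := fun k => if k = u ∨ k = v then a k - 1 else a k with ha'
      have hAC : ∀ k ∈ A ++ C, a' k = a k := by
        intro k hk
        have : k ≠ u ∧ k ≠ v := by
          rcases List.mem_append.1 hk with hk | hk
          · have := hAu k (by simp [hk]); exact ⟨this.ne, (this.trans huv).ne⟩
          · have := hCv k hk; exact ⟨(huv.trans this).ne', this.ne'⟩
        simp [ha', this]
      have hu' : a u = 1 + a' u := by simp [ha']
      have hv' : a v = 1 + a' v := by simp [ha']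
      have hmat : EqUpToSign (contProd ((A ++ u :: v :: C).map a')) matrixS := by
        have e1 : A.map a = A.map a' := List.map_congr_left fun k hk => (hAC k (by simp [hk])).symm
        have e2 : C.map a = C.map a' := List.map_congr_left fun k hk => (hAC k (by simp [hk])).symm
        have e3 : B.map a = List.replicate b 1 :=
          List.eq_replicate_iff.2 ⟨by rw [List.length_map]; exact hB.1, hB.2⟩
        simp only [List.map_append, List.map_cons, e1, e2, e3, hu', hv'] at h ⊢
        exact (contProd_glue (eqUpToSign_contProd_ear hb)).symm.trans h
      obtain ⟨f, x, t, cuts, h1, h2, h3, h4, h5, h6⟩ := ih _ (by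
          rw [← hn]; simp; omega) (A ++ u :: v :: C) (by simpa using hout) a' (by
          intro k hk
          have : k = u ∨ k = v ∨ k ∈ A ++ C := by
            simp only [List.mem_append, List.mem_cons] at hk ⊢; tauto
          rcases this with rfl | rfl | hk
          · omega
          · omega
          · rw [hAC k hk]; exact ha k (by simp at hk ⊢; tauto)) hmat rfl
      exact ⟨f, x, t, _, h1, h2, h3, h4.ear hl (by omega) (fun k hk => (hAC k hk).symm)
        (by omega) (by omega) hB1, Finset.mem_insert_of_mem h5, Finset.mem_insert_of_mem h6⟩
    · obtain ⟨R, T', rfl, hR, hT'⟩ := List.map_eq_append_iff.1 he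
      obtain ⟨x, T, rfl, hx, hT⟩ := List.map_eq_cons_iff.1 hT'
      rw [List.eq_replicate_iff, List.length_map] at hR hT
      -- In `1^r 2 1^s` the quadrilateral uses the notch, the first vertex, the vertex of weight 2
      -- and the last vertex. The inner vertices of the two ears number `r - 1` and `s - 1`, both 1
      -- modulo 3.
      obtain ⟨f, R, rfl⟩ := List.exists_cons_of_length_pos (show 0 < R.length by omega)
      obtain ⟨T, t, rfl⟩ := (List.eq_nil_or_concat' T).resolve_left (by rintro rfl; simp at hT; omega)
      have hR1 : ∀ k ∈ f :: R, a k = 1 := fun k hk => hR.2 _ (List.mem_map_of_mem hk)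
      have hT1 : ∀ k ∈ T ++ [t], a k = 1 := fun k hk => hT.2 _ (List.mem_map_of_mem hk)
      simp only [List.length_cons, List.length_append, List.length_nil] at hR hT
      have hl2 : (((z :: f :: R) ++ x :: T) ++ t :: []).Pairwise (· < ·) := by simpa using hl
      obtain ⟨hxt, hRx, hTxt, -, -, hout⟩ := sorted_append_iff hl2
      have hl1 : (([z] ++ f :: R) ++ x :: [t]).Pairwise (· < ·) := by simpa using hout
      obtain ⟨hfx, hzf, hRfx, -, -, -⟩ := sorted_append_iff hl1
      have hzf := hzf z (by simp)
      -- Weights once only the ear on `(f, x)` is attached; the second ear raises `x` to 2 and `t`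
      -- to 1.
      set b : Fin N → ℤ := fun k => if k = t then 0 else 1 with hb
      have hbt : ∀ k, k < t → b k = 1 := fun k hk => by simp [hb, hk.ne]
      have q1 : Realizes z f x t (insert (f, x) ∅) ([] ++ f :: R ++ x :: [t]) b := by
        refine Realizes.ear (a := 0) (by simpa using realizes_quad hzf hfx hxt)
          (by simpa using hl1) (by omega) ?_ ?_ ?_ ?_
        · simp [hb]
        · simpa using hbt f (hfx.trans hxt)
        · simpa using hbt x hxt
        · exact fun k hk => hbt k ((hRfx k hk).2.trans hxt)
      have q2 : Realizes z f x t (insert (x, t) (insert (f, x) ∅))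
          ((f :: R) ++ x :: T ++ t :: []) a := by
        refine Realizes.ear (a := b) (by simpa using q1) (by simpa using hl2)
          (by omega) ?_ ?_ ?_ ?_
        · intro k hk
          rw [List.append_nil] at hk
          rw [hR1 k hk, hbt k ((hRx k (by simp at hk ⊢; tauto)).trans hxt)]
        · rw [hbt x hxt, hx]; rfl
        · rw [hT1 t (by simp)]; simp [hb]
        · exact fun k hk => hT1 k (by simp [hk])
      exact ⟨f, x, t, _, hzf, hfx, hxt, by simpa using q2, by simp, by simp⟩

end Quiddity

/-! ### The notch and the equivalence -/

theorem isPolygonSide_univ_zero {n : ℕ} {k : Fin (n + 1)}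
    (h : IsPolygonSide Finset.univ ((0 : Fin (n + 1)), k)) : k.val = 1 ∨ k = Fin.last n := by
  obtain ⟨-, -, h3, h4 | h4⟩ := h
  · left
    have hk : 0 < k.val := h3
    have hlt : 1 < n + 1 := by omega
    have := h4 ⟨1, hlt⟩ (Finset.mem_univ _)
    simp only [Fin.le_def, Fin.val_zero] at this
    omega
  · right
    exact le_antisymm (Fin.le_last k) (h4 (Fin.last n) (Finset.mem_univ _)).2

/-- The sub-polygons at the notch are only the quadrilateral. -/
theorem PolygonDissection.IsNotched.weight_zero {n : ℕ} {D : PolygonDissection (n + 1)}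
    (h : D.IsNotched) : D.weight 0 = 0 := by
  obtain ⟨hn, q, hq, hq4, hdvd, hcard, hzero⟩ := h
  set i : Fin (n + 1) := ⟨1, by omega⟩ with hi
  set t := Fin.last n with ht
  -- Only two sides of `P` contain 0, so the two outer sides of the quadrilateral are exactly these,
  -- and its vertices are `0, 1, x, n`.
  have hsub : outerSides q ⊆ {(0, i), (0, t)} := by
    intro e he
    have h0 := hzero e he
    obtain ⟨-, hs⟩ := (Finset.mem_filter.1 he).2
    obtain ⟨e1, e2⟩ := e
    have hlt : e1 < e2 := hs.2.2.1
    have he1 : e1 = 0 := h0.resolve_right fun h => by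
      simp only at h; subst h; exact absurd hlt (Fin.not_lt_zero _)
    subst he1
    rcases isPolygonSide_univ_zero hs with h | h
    · simp [hi, Fin.ext_iff, h]
    · simp [h, ht]
  have heq : outerSides q = {(0, i), (0, t)} :=
    Finset.eq_of_subset_of_card_le hsub (hcard ▸ Finset.card_le_two)
  have hi' : IsPolygonSide q (0, i) :=
    (Finset.mem_filter.1 (show ((0 : Fin (n + 1)), i) ∈ outerSides q by simp [heq])).2.1
  have ht' : IsPolygonSide q (0, t) :=
    (Finset.mem_filter.1 (show ((0 : Fin (n + 1)), t) ∈ outerSides q by simp [heq])).2.1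
  have h0i : (0 : Fin (n + 1)) < i := hi'.2.2.1
  have hit : i < t := by simp [hi, ht, Fin.lt_def]; omega
  obtain ⟨x, hx, hx'⟩ := Finset.exists_mem_notMem_of_card_lt_card
    (s := {0, i, t}) (t := q) (Finset.card_le_three.trans_lt (by omega))
  simp only [Finset.mem_insert, Finset.mem_singleton, not_or] at hx'
  have hxt : x < t := lt_of_le_of_ne (Fin.le_last x) hx'.2.2
  have hix : i < x := by
    have h1 : x.val ≠ 0 := fun h => hx'.1 (Fin.ext h)
    have h2 : x.val ≠ 1 := fun h => hx'.2.1 (Fin.ext h)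
    simp only [hi, Fin.lt_def]
    omega
  have hqeq : q = {0, i, x, t} := by
    refine (Finset.eq_of_subset_of_card_le (fun k hk => ?_) ?_).symm
    · simp only [Finset.mem_insert, Finset.mem_singleton] at hk
      rcases hk with rfl | rfl | rfl | rfl
      exacts [hi'.1, hi'.2.1, hx, ht'.2.1]
    · rw [hq4, card_quad h0i hix hxt]
  have hcut : ∀ e : Fin (n + 1) × Fin (n + 1), IsPolygonSide q e → e.1 ≠ 0 → e ∈ D.cuts := by
    intro e he he0
    rw [D.pieces_eq_subPieces, mem_subPieces] at hq
    refine (hq.2.2.1 e he).resolve_left fun hs => ?_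
    have : e ∈ outerSides q := Finset.mem_filter.2 ⟨Finset.mem_univ _, he, hs⟩
    refine (hzero e this).elim he0 fun h => ?_
    have := he.2.2.1
    rw [h] at this
    exact absurd this (Fin.not_lt_zero _)
  have hmemq : ∀ k ∈ q, k = 0 ∨ k = i ∨ k = x ∨ k = t := fun k hk => by simpa [hqeq] using hk
  have c1 : (i, x) ∈ D.cuts := hcut _ ⟨hi'.2.1, hx, hix, Or.inl fun k hk => by
    rcases hmemq k hk with rfl | rfl | rfl | rfl <;> grind⟩ h0i.ne'
  have c2 : (x, t) ∈ D.cuts := hcut _ ⟨hx, ht'.2.1, hxt, Or.inl fun k hk => by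
    rcases hmemq k hk with rfl | rfl | rfl | rfl <;> grind⟩ (h0i.trans hix).ne'
  rw [PolygonDissection.weight, Finset.card_eq_zero, Finset.filter_eq_empty_iff]
  rintro P hP ⟨h3, h0⟩
  rw [D.pieces_eq_subPieces] at hP hq
  -- A piece containing 0 lies outside both cuts `(1, x)` and `(x, n)`, hence inside the
  -- quadrilateral, and equals it by the antichain property; but 3 does not divide 4.
  have p1 := (subset_innerPart_or_outerPart c1 (D.isDiagonal _ c1) (D.noncrossing _ c1)
    hP).resolve_left fun h => absurd (mem_innerPart.1 (h h0)).2.1 (not_le.2 h0i)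
  have p2 := (subset_innerPart_or_outerPart c2 (D.isDiagonal _ c2) (D.noncrossing _ c2)
    hP).resolve_left fun h => absurd (mem_innerPart.1 (h h0)).2.1 (not_le.2 (h0i.trans hix))
  have hPq : P ⊆ q := by
    intro k hk
    have a1 := (mem_outerPart.1 (p1 hk)).2
    have a2 := (mem_outerPart.1 (p2 hk)).2
    have a3 : t ≤ k ↔ k = t := ⟨fun h => le_antisymm (Fin.le_last k) h, fun h => h.ge⟩
    have a4 : k ≤ i → k = 0 ∨ k = i := by
      simp only [hi, Fin.le_def, Fin.ext_iff, Fin.val_zero]; omega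
    rw [hqeq]
    simp only [Finset.mem_insert, Finset.mem_singleton]
    grind
  rw [subPieces_antichain hP hq hPq] at h3
  omega

theorem PolygonDissection.IsNotched.weight_pos {n : ℕ} {D : PolygonDissection (n + 1)}
    (h : D.IsNotched) (v : Fin (n + 1)) (hv : v ≠ 0) : 0 < D.weight v := by
  obtain ⟨hn, q, hq, hq4, hdvd, hcard, hzero⟩ := h
  -- The side is `(v, v + 1)`, or `(v - 1, v)` when `v` is the last vertex, so as to avoid 0.
  obtain ⟨e, he, he0, hve⟩ : ∃ e : Fin (n + 1) × Fin (n + 1),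
      IsPolygonSide Finset.univ e ∧ e.1 ≠ 0 ∧ (v = e.1 ∨ v = e.2) := by
    have hv' : v.val ≠ 0 := fun h => hv (Fin.ext h)
    by_cases hl : v.val < n
    · refine ⟨(v, ⟨v.val + 1, by omega⟩), ⟨Finset.mem_univ _, Finset.mem_univ _, ?_,
        Or.inl fun k _ => ?_⟩, hv, Or.inl rfl⟩
      · simp [Fin.lt_def]
      · simp only [Fin.le_def]; omega
    · refine ⟨(⟨v.val - 1, by omega⟩, v), ⟨Finset.mem_univ _, Finset.mem_univ _, ?_,
        Or.inl fun k _ => ?_⟩, ?_, Or.inr rfl⟩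
      · simp only [Fin.lt_def]; omega
      · simp only [Fin.le_def]; omega
      · simp only [ne_eq, Fin.ext_iff, Fin.val_zero]; omega
  obtain ⟨P, hP, hPe⟩ := exists_subPiece_side (cuts := D.cuts) D.noncrossing
    (by rw [Finset.card_fin]; omega) he
  rw [← D.pieces_eq_subPieces] at hP
  refine Finset.card_pos.2 ⟨P, Finset.mem_filter.2 ⟨hP, hdvd P hP ?_, ?_⟩⟩
  · rintro rfl
    refine (hzero e (Finset.mem_filter.2 ⟨Finset.mem_univ _, hPe, he⟩)).elim he0 fun h => ?_
    have := he.2.2.1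
    rw [h] at this
    exact absurd this (Fin.not_lt_zero _)
  · rcases hve with rfl | rfl
    exacts [hPe.1, hPe.2.1]

theorem PolygonDissection.IsNotched.contProd_quiddity {n : ℕ} {D : PolygonDissection (n + 1)}
    (h : D.IsNotched) : EqUpToSign (continuantMatrix D.notchedQuiddity) matrixS := by
  have h0 := h.weight_zero
  obtain ⟨hn, q, hq, hq4, hdvd, -⟩ := h
  have key := contProd_subWeight D.noncrossing Finset.univ (by rw [Finset.card_fin]; omega)
    (fun P hP => by
      rw [← D.pieces_eq_subPieces] at hP
      by_cases hPq : P = q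
      · exact Or.inr (hPq ▸ hq4)
      · exact Or.inl (hdvd P hP hPq))
    (List.finRange (n + 1)) (List.pairwise_lt_finRange _) (by ext; simp)
  simp only [← D.weight_eq_subWeight] at key
  rw [List.finRange_succ, List.map_cons, contProd_cons, h0, List.map_map] at key
  have hl : (List.finRange n).map ((fun v => (D.weight v : ℤ)) ∘ Fin.succ) =
      List.ofFn D.notchedQuiddity := by
    rw [List.ofFn_eq_map]; rfl
  rw [hl, ← continuantMatrix_eq_contProd] at key
  have hS : stepMatrix ((0 : ℕ) : ℤ) = matrixS := rfl
  have hSS : matrixS * matrixS = -1 := by unfold matrixS; decide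
  -- The factor `C(0) = S` of the notch is cancelled by `S ^ 2 = -1`.
  have h1 := key.mul_right matrixS
  rw [hS, mul_assoc, hSS, one_mul, mul_neg_one] at h1
  exact EqUpToSign.trans (Or.inr (neg_neg _).symm) h1

theorem exists_isNotched {n : ℕ} (a : Fin n → ℤ) (ha : ∀ i, 0 < a i)
    (h : EqUpToSign (continuantMatrix a) matrixS) :
    ∃ D : PolygonDissection (n + 1), D.IsNotched ∧ D.notchedQuiddity = a := by
  have hfin : (0 : Fin (n + 1)) :: (List.finRange n).map Fin.succ = List.finRange (n + 1) :=
    (List.finRange_succ).symm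
  have huniv : ((0 : Fin (n + 1)) :: (List.finRange n).map Fin.succ).toFinset = Finset.univ := by
    rw [hfin]; ext; simp
  obtain ⟨f, x, t, cuts, h0f, hfx, hxt, hR, c1, c2⟩ := exists_realizes (0 : Fin (n + 1))
    ((List.finRange n).map Fin.succ) (by rw [hfin]; exact List.pairwise_lt_finRange _)
    -- The value 0 at the notch is a filler: only the vertices in the list are constrained.
    (Fin.cons 0 a) (fun v hv => by
      obtain ⟨i, -, rfl⟩ := List.mem_map.1 hv
      simpa using ha i) (by
      rw [List.map_map]
      have : (List.finRange n).map ((Fin.cons 0 a : Fin (n + 1) → ℤ) ∘ Fin.succ) =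
          List.ofFn a := by
        rw [List.ofFn_eq_map]; rfl
      rwa [this, ← continuantMatrix_eq_contProd])
  obtain ⟨hdiag, hcross, hquad, hdvd, hweight, hbounds⟩ := hR
  rw [huniv] at hdiag hquad hdvd hweight
  have hb : ∀ k : Fin (n + 1), k = 0 ∨ f ≤ k ∧ k ≤ t := fun k => by
    refine or_iff_not_imp_left.2 fun hk => hbounds k ?_
    obtain ⟨j, rfl⟩ := Fin.exists_succ_eq.2 hk
    simp
  have h4 := card_quad h0f hfx hxt
  have hd1 := isPolygonDiagonal_iff.1 (hdiag _ c1)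
  have hd2 := isPolygonDiagonal_iff.1 (hdiag _ c2)
  refine ⟨⟨cuts, hdiag, hcross⟩, ⟨?_, {0, f, x, t}, ?_, h4, ?_, ?_⟩, ?_⟩
  -- Both cuts are diagonals, so `0 < f < k < x < m < t ≤ n`, which gives `n ≥ 5`.
  · obtain ⟨-, -, -, ⟨k, -, hk1, hk2⟩, -⟩ := hd1
    obtain ⟨-, -, -, ⟨m, -, hm1, hm2⟩, -⟩ := hd2
    have := t.isLt
    simp only [Fin.lt_def, Fin.val_zero] at *
    omega
  · rw [PolygonDissection.pieces_eq_subPieces]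
    exact hquad
  · rw [PolygonDissection.pieces_eq_subPieces]
    exact hdvd
  · have hside : ∀ s, s = f ∨ s = t → IsPolygonSide Finset.univ ((0 : Fin (n + 1)), s) := by
      rintro s (rfl | rfl)
      · exact ⟨Finset.mem_univ _, Finset.mem_univ _, h0f, Or.inl fun k _ =>
          (hb k).imp (fun h => h.le) And.left⟩
      · exact ⟨Finset.mem_univ _, Finset.mem_univ _, h0f.trans (hfx.trans hxt), Or.inr fun k _ =>
          ⟨Fin.zero_le k, (hb k).elim (fun h => by rw [h]; exact Fin.zero_le _) And.right⟩⟩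
    have houter : outerSides {0, f, x, t} = {((0 : Fin (n + 1)), f), (0, t)} := by
      ext ⟨e1, e2⟩
      simp only [outerSides, Finset.mem_filter, Finset.mem_univ, true_and, Finset.mem_insert,
        Finset.mem_singleton, Prod.mk.injEq]
      constructor
      · rintro ⟨hq, hu⟩
        have n1 : ¬ (e1 = f ∧ e2 = x) := by
          rintro ⟨rfl, rfl⟩; exact (hdiag _ c1).2.2.2 hu
        have n2 : ¬ (e1 = x ∧ e2 = t) := by
          rintro ⟨rfl, rfl⟩; exact (hdiag _ c2).2.2.2 hu
        obtain ⟨q1, q2, q3, q4⟩ := hq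
        simp only [Finset.mem_insert, Finset.mem_singleton, forall_eq_or_imp, forall_eq] at q1 q2 q3 q4
        grind
      · have hmono := fun s hs => (hside s hs).mono (Finset.subset_univ {0, f, x, t})
        rintro (⟨rfl, rfl⟩ | ⟨rfl, rfl⟩)
        · exact ⟨hmono _ (Or.inl rfl) (by simp) (by simp), hside _ (Or.inl rfl)⟩
        · exact ⟨hmono _ (Or.inr rfl) (by simp) (by simp), hside _ (Or.inr rfl)⟩
    rw [houter]
    refine ⟨Finset.card_pair fun h => (hfx.trans hxt).ne (Prod.mk.inj h).2, ?_⟩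
    simp
  · funext i
    have := hweight i.succ (by simp)
    rw [Fin.cons_succ] at this
    rw [PolygonDissection.notchedQuiddity, PolygonDissection.weight_eq_subWeight]
    exact this

theorem mainTheorem1 (n : ℕ) (a : Fin n → ℤ) :
    ((∀ i, 0 < a i) ∧ (continuantMatrix a = matrixS ∨ continuantMatrix a = -matrixS)) ↔
      ∃ D : PolygonDissection (n + 1), D.IsNotched ∧ D.notchedQuiddity = a := by
  constructor
  · rintro ⟨ha, h⟩
    exact exists_isNotched a ha h
  · rintro ⟨D, hD, rfl⟩
    exact ⟨fun i => Int.natCast_pos.2 (hD.weight_pos _ (Fin.succ_ne_zero i)),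
      hD.contProd_quiddity⟩
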